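/- **Setting.** Let $F_h$ and $F_g$ be class-$\mathcal C$ distribution functions. Here a distribution function $F$ is of class $\mathcal C$ with tail exponent $n>0$ if it is continuous, $F(x)=0$ for $x\le 0$, $F$ is strictly increasing on $(0,\infty)$, there are $\alpha>0$, $\beta>0$, $l\in\mathbb R$ and a function $H$ with $H(x)=o(x^{n})$ as $x\to\infty$ such that $$\lim_{x\to\infty}\frac{1-F(x)}{\alpha x^{l}e^{-\beta x^{n}+H(x)}}=1,$$ and there are $\eta>0$, $\gamma>0$ with $\lim_{x\downarrow 0}F(x)/(\eta x^{\gamma})=1$. Let $n_h$ be the tail exponent of $F_h$. $N$ secondary users have independent pairs of channel power gains $(h_i,g_i)$, $i=1,\dots,N$, each distributed as $(h,g)$, where $h\sim F_h$ (gain to the secondary base station) and $g\sim F_g$ (gain to the primary base station) are independent. All users apply the same policy, which consists of a measurable power allocation $P(h,g)\ge 0$ and a measurable scheduling function $S(h,g)\in\{0,1\}$. Let $P_{\rm ave}>0$ and $Q_{\rm ave}>0$ be constants not depending on $N$, and take the scheduling probability $p=1/N$. A policy is optimal for $N\geq 2$ users if it solves $$\begin{aligned}\text{maximize}\quad & \mathbb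 E\big[\log(1+hP(h,g))\,\mathbf 1\{S(h,g)=1\}\big]\\ \text{subject to}\quad & \mathbb E\big[P(h,g)\,\mathbf 1\{S(h,g)=1\}\big]\le P_{\rm ave}/N,\\ & \mathbb E\big[gP(h,g)\,\mathbf 1\{S(h,g)=1\}\big]\le Q_{\rm ave}/N,\\ & \Pr\{S(h,g)=1\}=1/N.\end{aligned}$$ Over the collision channel, user $i$ is received at rate $\log(1+h_iP(h_i,g_i))$ if it transmits and no other user does; if two or more users transmit, nothing is received. The sum-rate is $$R(N)=\mathbb E\Big[\sum_{i=1}^{N}\log\big(1+h_iP(h_i,g_i)\big)\,\mathbf 1\{\text{user } i \text{ transmits and no user } j\ne i \text{ transmits}\}\Big].$$ User $i$ transmits if $S(h_i,g_i)=1$; alternatively, one may require also $P(h_i,g_i)>0$, so that a scheduled user with zero power is silent. **Theorem.** For each $N\ge 2$ let $R(N)$ be the sum-rate under an optimal policy for $N$ users. Then, under either convention on transmission, $$\lim_{N\to\infty}\frac{R(N)}{\log\log N}=\frac{1}{e\,n_h}.$$ -/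

import Mathlib

open MeasureTheory ProbabilityTheory Filter Topology

/-- The distribution function `F` is a class-`C` distribution function with tail exponent `n`:
continuous, vanishing on `(-∞, 0]`, strictly increasing on `(0, ∞)`, with
`1 - F x ~ α x ^ l exp (-β x ^ n + H x)` at infinity, where `H x = o(x ^ n)`,
and `F x ~ η x ^ γ` at the origin. No regularity of `H` beyond `H x = o(x ^ n)` is asked for. -/
structure IsClassC (F : ℝ → ℝ) (n : ℝ) : Prop where
  continuous : Continuous F
  eq_zero_of_nonpos : ∀ x, x ≤ 0 → F x = 0
  strictMonoOn : StrictMonoOn F (Set.Ioi 0)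
  exponent_pos : 0 < n
  tail : ∃ (α β l : ℝ) (H : ℝ → ℝ), 0 < α ∧ 0 < β ∧ H =o[atTop] (fun x : ℝ => x ^ n) ∧
    Tendsto (fun x : ℝ => (1 - F x) / (α * x ^ l * Real.exp (-β * x ^ n + H x))) atTop (𝓝 1)
  origin : ∃ η γ : ℝ, 0 < η ∧ 0 < γ ∧
    Tendsto (fun x : ℝ => F x / (η * x ^ γ)) (𝓝[>] 0) (𝓝 1)

/-- A distributed power allocation and scheduling policy, used by every secondary user.
A channel state is a pair `x = (h, g)` of the user's own gains: `x.1 = h` is the gain to the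
secondary base station and `x.2 = g` is the gain to the primary base station.
`power x` is the transmission power `P (h, g)`, and `sched` is the set of the states with
`S (h, g) = 1`. -/
structure Policy where
  power : ℝ × ℝ → ℝ
  sched : Set (ℝ × ℝ)
  measurable_power : Measurable power
  power_nonneg : ∀ x, 0 ≤ power x
  measurableSet_sched : MeasurableSet sched

namespace Policy

/-- The scheduled states at which the allotted power is positive. -/
def active (π : Policy) : Set (ℝ × ℝ) := {x | x ∈ π.sched ∧ 0 < π.power x}

/-- The rate `log (1 + h P (h, g))`, in nats, at the state `x = (h, g)`. -/
noncomputable def rate (π : Policy) (x : ℝ × ℝ) : ℝ := Real.log (1 + x.1 * π.power x)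

/-- The objective `E [log (1 + h P (h, g)) 1{S (h, g) = 1}]`, where `ν` is the joint law of
`(h, g)`; the integrand is nonnegative for nonnegative gains. -/
noncomputable def meanRate (ν : Measure (ℝ × ℝ)) (π : Policy) : ENNReal :=
  ∫⁻ x in π.sched, ENNReal.ofReal (π.rate x) ∂ν

/-- The constraints on the average total power, on the average interference power and on the
scheduling probability, for `N` users with power budget `Pave`, interference budget `Qave` and
scheduling probability `p`. -/
structure Feasible (ν : Measure (ℝ × ℝ)) (Pave Qave : ℝ) (N : ℕ) (p : ℝ) (π : Policy) :
    Prop where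
  power_le : ∫⁻ x in π.sched, ENNReal.ofReal (π.power x) ∂ν ≤ ENNReal.ofReal (Pave / N)
  interference_le :
    ∫⁻ x in π.sched, ENNReal.ofReal (x.2 * π.power x) ∂ν ≤ ENNReal.ofReal (Qave / N)
  sched_prob : ν π.sched = ENNReal.ofReal p

/-- `π` solves the problem of maximizing `meanRate` over all feasible policies. -/
def IsOptimal (ν : Measure (ℝ × ℝ)) (Pave Qave : ℝ) (N : ℕ) (p : ℝ) (π : Policy) : Prop :=
  π.Feasible ν Pave Qave N p ∧
    ∀ π' : Policy, π'.Feasible ν Pave Qave N p → π'.meanRate ν ≤ π.meanRate ν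

open Classical in
/-- The sum-rate of `N` users over the collision channel, where `T` is the set of the states in
which a user transmits. The states `ω 0, …, ω (N - 1)` of the users are independent with law `ν`;
user `i` is received at rate `π.rate (ω i)` if it transmits and no other user does, and otherwise
it contributes nothing. -/
noncomputable def sumRate (ν : Measure (ℝ × ℝ)) (N : ℕ) (π : Policy) (T : Set (ℝ × ℝ)) : ℝ :=
  ∫ ω : Fin N → ℝ × ℝ,
    ∑ i, (if ω i ∈ T ∧ ∀ j, j ≠ i → ω j ∉ T then π.rate (ω i) else 0)
      ∂(Measure.pi fun _ : Fin N => ν)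

end Policy

/-! By independence the sum-rate is `N` times the mean rate times `(1 - q) ^ (N - 1)`, with `q` the
transmission probability. It suffices that `N` times the optimal mean rate is asymptotic to `log
(log N) / nh`, and that `N * q → 1`, which gives the factor `1 / e`.

Upper bound (`IsClassC.exists_setLIntegral_rate_le`): power adds at most `Pave / N` to the mean
rate, and gains above a level `t` of order `(log N) ^ (1 / nh)` add `O(1 / N)`, so only `log (1 + t)
* q` matters. Lower bound (`IsClassC.exists_le_meanRate`): constant power above a threshold for `h`
is feasible because `g` has finite mean. Both levels are constant multiples of `(log N) ^ (1 / nh)`;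
the logarithm forgets the constants, so crude tail bounds suffice.

Taking `q` in the upper bound as the probability of positive power, the two bounds also force `N * q
→ 1`; hence the convention on zero power is immaterial. -/

/-! ### Tails and moments of class-`C` laws -/

/-- The tail of a class-`C` distribution function lies between two stretched exponentials. -/
theorem IsClassC.tail_bounds {F : ℝ → ℝ} {n : ℝ} (hF : IsClassC F n) :
    ∃ b B : ℝ, 0 < b ∧ 0 < B ∧ ∀ᶠ x : ℝ in atTop,
      Real.exp (-B * x ^ n) ≤ 1 - F x ∧ 1 - F x ≤ Real.exp (-b * x ^ n) := by
  obtain ⟨α, β, l, H, hα, hβ, hH, hlim⟩ := hF.tail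
  have hn := hF.exponent_pos
  refine ⟨β / 2, 2 * β, by positivity, by positivity, ?_⟩
  have hnorm : Tendsto (norm ∘ fun x : ℝ => x ^ n) atTop atTop :=
    tendsto_norm_atTop_atTop.comp (tendsto_rpow_atTop hn)
  have hlog := hlim.log one_ne_zero
  -- Where `x > 0` and `F x < 1`, this function is `log (1 - F x) + β * x ^ n`.
  have herr : (fun x : ℝ => Real.log ((1 - F x) / (α * x ^ l * Real.exp (-β * x ^ n + H x)))
      + Real.log α + l * Real.log x + H x) =o[atTop] (fun x : ℝ => x ^ n) := by
    refine ((Asymptotics.IsLittleO.add ?_ ?_).add ?_).add hH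
    · exact (hlog.isBigO_one ℝ).trans_isLittleO (Asymptotics.isLittleO_const_left.2 (.inr hnorm))
    · exact Asymptotics.isLittleO_const_left.2 (.inr hnorm)
    · exact (isLittleO_log_rpow_atTop hn).const_mul_left l
  filter_upwards [herr.bound (half_pos hβ), hlim.eventually_const_lt zero_lt_one,
    eventually_gt_atTop 0] with x hx hpos hx0
  have hxn : 0 < x ^ n := Real.rpow_pos_of_pos hx0 n
  have hxl : 0 < x ^ l := Real.rpow_pos_of_pos hx0 l
  have hD : 0 < α * x ^ l * Real.exp (-β * x ^ n + H x) := by positivity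
  have h1F : 0 < 1 - F x := by simpa using (div_pos_iff_of_pos_right hD).1 hpos
  rw [Real.log_div h1F.ne' hD.ne', Real.log_mul (by positivity) (Real.exp_ne_zero _),
    Real.log_exp, Real.log_mul hα.ne' hxl.ne', Real.log_rpow hx0, Real.norm_eq_abs,
    Real.norm_eq_abs, abs_of_pos hxn, abs_le] at hx
  rw [← Real.le_log_iff_exp_le h1F, ← Real.log_le_iff_le_exp h1F]
  constructor <;> nlinarith [hx.1, hx.2]

/-- Take the power `1 / n` of `y ≤ exp y` at `y = c * n * x ^ n`. -/
theorem le_rpow_mul_exp_rpow {n c x : ℝ} (hn : 0 < n) (hc : 0 < c) (hx : 0 ≤ x) :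
    x ≤ (c * n) ^ (-(1 / n)) * Real.exp (c * x ^ n) := by
  have hcn : 0 < c * n := by positivity
  have hxn : 0 ≤ x ^ n := Real.rpow_nonneg hx n
  have h : c * n * x ^ n ≤ Real.exp (c * n * x ^ n) := by
    linarith [Real.add_one_le_exp (c * n * x ^ n)]
  have h2 := Real.rpow_le_rpow (by positivity) h (by positivity : 0 ≤ 1 / n)
  rw [Real.mul_rpow hcn.le hxn, ← Real.rpow_mul hx, mul_one_div_cancel hn.ne', Real.rpow_one,
    ← Real.exp_mul] at h2
  have h3 : c * n * x ^ n * (1 / n) = c * x ^ n := by field_simp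
  rw [h3] at h2
  rw [Real.rpow_neg hcn.le, inv_mul_eq_div, le_div_iff₀ (by positivity)]
  linarith

theorem measure_Ioi_eq_one_sub_cdf (μ : Measure ℝ) [IsProbabilityMeasure μ] (x : ℝ) :
    μ (Set.Ioi x) = ENNReal.ofReal (1 - cdf μ x) := by
  rw [← Set.compl_Iic, prob_compl_eq_one_sub measurableSet_Iic, ← ofReal_cdf μ x,
    ENNReal.ofReal_sub _ (cdf_nonneg μ x), ENNReal.ofReal_one]

theorem IsClassC.ae_pos {μ : Measure ℝ} [IsProbabilityMeasure μ] {n : ℝ}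
    (hF : IsClassC (cdf μ) n) : ∀ᵐ x ∂μ, 0 < x := by
  have h : μ (Set.Iic 0) = 0 := by
    rw [← ofReal_cdf μ 0, hF.eq_zero_of_nonpos 0 le_rfl, ENNReal.ofReal_zero]
  filter_upwards [measure_eq_zero_iff_ae_notMem.1 h] with x hx
  simpa using hx

/-- A class-`C` law has a finite stretched exponential moment. -/
theorem IsClassC.exists_exp_moment {μ : Measure ℝ} [IsProbabilityMeasure μ] {n : ℝ}
    (hF : IsClassC (cdf μ) n) :
    ∃ c K : ℝ, 0 < c ∧ 0 ≤ K ∧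
      ∫⁻ x, ENNReal.ofReal (Real.exp (c * x ^ n)) ∂μ ≤ ENNReal.ofReal K := by
  obtain ⟨b, _, hb, _, htail⟩ := hF.tail_bounds
  have hn := hF.exponent_pos
  -- Half the decay rate: the layer `k < x ^ n ≤ k + 1` contributes at most `exp (c * (k + 1)) * exp
  -- (-b * k)`, which is geometric in `k`.
  set c := b / 2 with hc
  have hcpos : 0 < c := by positivity
  let r : ℕ → ℝ := fun k => (k : ℝ) ^ (1 / n)
  let a : ℕ → ℝ := fun k => Real.exp (c * (k + 1)) * (1 - cdf μ (r k))
  have ha : ∀ k, 0 ≤ a k := fun k =>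
    mul_nonneg (Real.exp_pos _).le (sub_nonneg.2 (cdf_le_one μ _))
  have hr : Tendsto r atTop atTop :=
    (tendsto_rpow_atTop (by positivity : 0 < 1 / n)).comp tendsto_natCast_atTop_atTop
  have hrn : ∀ k, r k ^ n = k := fun k => by
    simp only [r]
    rw [← Real.rpow_mul (Nat.cast_nonneg k), one_div_mul_cancel hn.ne', Real.rpow_one]
  have hgeo : Summable fun k : ℕ => Real.exp c * Real.exp (k * (-c)) :=
    (Real.summable_exp_nat_mul_iff.2 (by linarith)).mul_left _
  have hsum : Summable a := by
    refine Summable.of_norm_bounded_eventually_nat hgeo ?_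
    filter_upwards [hr.eventually htail] with k hk
    rw [Real.norm_eq_abs, abs_of_nonneg (ha k)]
    refine (mul_le_mul_of_nonneg_left hk.2 (Real.exp_pos _).le).trans (le_of_eq ?_)
    rw [hrn, ← Real.exp_add, ← Real.exp_add, hc]
    ring_nf
  refine ⟨c, ∑' k, a k, hcpos, tsum_nonneg ha, ?_⟩
  calc ∫⁻ x, ENNReal.ofReal (Real.exp (c * x ^ n)) ∂μ
      ≤ ∫⁻ x, ∑' k : ℕ, (Set.Ioi (r k)).indicator
          (fun _ => ENNReal.ofReal (Real.exp (c * (k + 1)))) x ∂μ := by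
        refine lintegral_mono_ae ?_
        filter_upwards [hF.ae_pos] with x hx
        have hxn : 0 < x ^ n := Real.rpow_pos_of_pos hx n
        -- The ceiling, not the floor, gives the strict `k < x ^ n` needed for the open ray.
        obtain ⟨k, hk⟩ : ∃ k : ℕ, ⌈x ^ n⌉₊ = k + 1 :=
          Nat.exists_eq_succ_of_ne_zero (Nat.ceil_pos.2 hxn).ne'
        have hk1 : (k : ℝ) < x ^ n := Nat.lt_ceil.1 (by omega)
        have hk2 : x ^ n ≤ k + 1 := by
          have := Nat.le_ceil (x ^ n)
          rw [hk] at this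
          exact_mod_cast this
        refine le_trans ?_ (ENNReal.le_tsum k)
        have hmem : x ∈ Set.Ioi (r k) := by
          have h := Real.rpow_lt_rpow (Nat.cast_nonneg k) hk1 (by positivity : 0 < 1 / n)
          rwa [← Real.rpow_mul hx.le, mul_one_div_cancel hn.ne', Real.rpow_one] at h
        rw [Set.indicator_of_mem hmem]
        gcongr
    _ = ∑' k : ℕ, ENNReal.ofReal (a k) := by
        rw [lintegral_tsum fun k =>
          (measurable_const.indicator measurableSet_Ioi).aemeasurable]
        refine tsum_congr fun k => ?_
        rw [lintegral_indicator_const measurableSet_Ioi, measure_Ioi_eq_one_sub_cdf,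
          ← ENNReal.ofReal_mul (Real.exp_pos _).le]
    _ = ENNReal.ofReal (∑' k, a k) := (ENNReal.ofReal_tsum_of_nonneg ha hsum).symm

/-- The numerator is `log y / n` plus a bounded term; it is applied at `y = log N`. -/
theorem tendsto_log_rpow_div_log {n p B : ℝ} (hn : 0 < n) (hp : 0 < p) (hB : 0 < B) :
    Tendsto (fun y : ℝ => Real.log (1 + p * (y / B) ^ (1 / n)) / Real.log y) atTop
      (𝓝 (1 / n)) := by
  have hu : Tendsto (fun y : ℝ => p * (y / B) ^ (1 / n)) atTop atTop :=
    ((tendsto_rpow_atTop (by positivity : 0 < 1 / n)).comp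
      (tendsto_id.atTop_div_const hB)).const_mul_atTop hp
  have h1 : Tendsto (fun y : ℝ => Real.log (1 + (p * (y / B) ^ (1 / n))⁻¹)) atTop (𝓝 0) := by
    have := (tendsto_inv_atTop_zero.comp hu).const_add 1
    simpa using this.log (by simp)
  have h2 : Tendsto (fun y : ℝ => 1 / n + (Real.log p - Real.log B / n
      + Real.log (1 + (p * (y / B) ^ (1 / n))⁻¹)) / Real.log y) atTop (𝓝 (1 / n)) := by
    simpa using ((h1.const_add _).div_atTop Real.tendsto_log_atTop).const_add (1 / n)
  refine h2.congr' ?_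
  filter_upwards [eventually_gt_atTop 1] with y hy
  have hy0 : 0 < y := by linarith
  have hpos : 0 < (y / B) ^ (1 / n) := Real.rpow_pos_of_pos (by positivity) _
  have hl : 0 < Real.log y := Real.log_pos hy
  have e : 1 + p * (y / B) ^ (1 / n)
      = p * (y / B) ^ (1 / n) * (1 + (p * (y / B) ^ (1 / n))⁻¹) := by
    field_simp
    ring
  rw [e, Real.log_mul (by positivity) (by positivity), Real.log_mul hp.ne' hpos.ne',
    Real.log_rpow (by positivity), Real.log_div hy0.ne' hB.ne']
  field_simp
  ring

/-! ### Policies and the collision channel -/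

namespace Policy

theorem measurable_rate (π : Policy) : Measurable π.rate :=
  Real.measurable_log.comp ((measurable_fst.mul π.measurable_power).const_add 1)

theorem measurableSet_active (π : Policy) : MeasurableSet π.active :=
  π.measurableSet_sched.inter (measurableSet_lt measurable_const π.measurable_power)

theorem active_subset_sched (π : Policy) : π.active ⊆ π.sched := fun _ hx => hx.1

/-- Scheduled states with zero power do not contribute to the mean rate. -/
theorem setLIntegral_rate_of_active_subset (ν : Measure (ℝ × ℝ)) (π : Policy)
    {T : Set (ℝ × ℝ)} (hT : MeasurableSet T) (h₁ : π.active ⊆ T) (h₂ : T ⊆ π.sched) :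
    ∫⁻ x in T, ENNReal.ofReal (π.rate x) ∂ν = π.meanRate ν := by
  rw [meanRate, ← lintegral_indicator hT, ← lintegral_indicator π.measurableSet_sched]
  refine lintegral_congr fun x => ?_
  by_cases hx : x ∈ T
  · rw [Set.indicator_of_mem hx, Set.indicator_of_mem (h₂ hx)]
  · rw [Set.indicator_of_notMem hx]
    by_cases hs : x ∈ π.sched
    · have h0 : π.power x = 0 :=
        le_antisymm (not_lt.1 fun h => hx (h₁ ⟨hs, h⟩)) (π.power_nonneg x)
      simp [hs, rate, h0]
    · rw [Set.indicator_of_notMem hs]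

/-- Independence of the users turns the sum-rate into a product. -/
theorem sumRate_eq (ν : Measure (ℝ × ℝ)) [IsProbabilityMeasure ν] (N : ℕ) (π : Policy)
    {T : Set (ℝ × ℝ)} (hT : MeasurableSet T) (hint : IntegrableOn π.rate T ν) :
    π.sumRate ν N T = N * ((∫ x in T, π.rate x ∂ν) * (1 - ν.real T) ^ (N - 1)) := by
  classical
  -- The contribution of user `i` is a product over users `j` of functions of `ω j` alone.
  let f : Fin N → Fin N → ℝ × ℝ → ℝ := fun i j =>
    if j = i then T.indicator π.rate else Tᶜ.indicator 1
  have hf : ∀ i j, Integrable (f i j) ν := fun i j => by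
    by_cases h : j = i
    · simpa [f, h] using (integrable_indicator_iff hT).2 hint
    · simp only [f, h, if_false]
      exact (integrable_const (1 : ℝ)).indicator hT.compl
  have hprod : ∀ (ω : Fin N → ℝ × ℝ) (i : Fin N),
      (if ω i ∈ T ∧ ∀ j, j ≠ i → ω j ∉ T then π.rate (ω i) else 0) = ∏ j, f i j (ω j) := by
    intro ω i
    split_ifs with h
    · rw [Finset.prod_eq_single i]
      · simp [f, h.1]
      · intro j _ hj
        simp [f, hj, h.2 j hj]
      · simp
    · by_cases hi : ω i ∈ T
      · have : ∃ j, j ≠ i ∧ ω j ∈ T := by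
          by_contra! h'
          exact h ⟨hi, h'⟩
        obtain ⟨j, hj, hjT⟩ := this
        exact (Finset.prod_eq_zero (Finset.mem_univ j) (by simp [f, hj, hjT])).symm
      · exact (Finset.prod_eq_zero (Finset.mem_univ i) (by simp [f, hi])).symm
  have hcompl : ∫ x, Tᶜ.indicator (1 : ℝ × ℝ → ℝ) x ∂ν = 1 - ν.real T := by
    rw [integral_indicator_one hT.compl, probReal_compl_eq_one_sub hT]
  have hterm : ∀ i : Fin N, ∏ j, ∫ x, f i j x ∂ν
      = (∫ x in T, π.rate x ∂ν) * (1 - ν.real T) ^ (N - 1) := by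
    intro i
    rw [← Finset.mul_prod_erase _ _ (Finset.mem_univ i), Finset.prod_congr rfl
      (g := fun _ => 1 - ν.real T)]
    · simp [f, integral_indicator hT, Finset.card_erase_of_mem]
    · intro j hj
      simp only [f, Finset.ne_of_mem_erase hj, if_false, hcompl]
  simp only [sumRate]
  calc _ = ∫ ω : Fin N → ℝ × ℝ, ∑ i, ∏ j, f i j (ω j) ∂(Measure.pi fun _ : Fin N => ν) := by
        refine integral_congr_ae (.of_forall fun ω => Finset.sum_congr rfl fun i _ => ?_)
        rw [← hprod ω i]
    _ = _ := by
        rw [integral_finsetSum _ fun i _ => Integrable.fintype_prod (hf i)]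
        simp_rw [integral_fintype_prod_eq_prod, hterm]
        simp

end Policy

/-! ### Bounds on the mean rate -/

/-- On any event, the mean rate is at most that of the gain level `t`, up to the power spent
and a remainder accounting for the gains above `t`. -/
theorem IsClassC.exists_setLIntegral_rate_le {μh μg : Measure ℝ} [IsProbabilityMeasure μh]
    [IsProbabilityMeasure μg] {n : ℝ} (hh : IsClassC (cdf μh) n) :
    ∃ c D : ℝ, 0 < c ∧ 0 ≤ D ∧ ∀ (π : Policy) (A : Set (ℝ × ℝ)) (t : ℝ), 0 ≤ t →
      ∫⁻ x in A, ENNReal.ofReal (π.rate x) ∂(μh.prod μg) ≤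
        ENNReal.ofReal (Real.log (1 + t)) * (μh.prod μg) A
          + ENNReal.ofReal (D * Real.exp (-(c * t ^ n)))
          + ∫⁻ x in A, ENNReal.ofReal (π.power x) ∂(μh.prod μg) := by
  obtain ⟨c, K, hc, hK, hmom⟩ := hh.exists_exp_moment
  have hn := hh.exponent_pos
  -- Half of the exponent `c` absorbs the growth of `h`; the other half yields the decay in `t` when
  -- `h ≥ t`.
  have hc2 : 0 < c / 2 := by positivity
  set d : ℝ := (c / 2 * n) ^ (-(1 / n)) with hd
  have hd0 : 0 < d := Real.rpow_pos_of_pos (by positivity) _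
  refine ⟨c / 2, d * K, hc2, by positivity, fun π A t ht => ?_⟩
  have hpos : ∀ᵐ x ∂((μh.prod μg).restrict A), 0 < x.1 :=
    ae_restrict_of_ae ((measurePreserving_fst (μ := μh) (ν := μg)).quasiMeasurePreserving.ae
      hh.ae_pos)
  set e : ℝ := d * Real.exp (-(c / 2 * t ^ n)) with he
  have he0 : 0 ≤ e := by positivity
  have hm : Measurable fun x : ℝ => ENNReal.ofReal (Real.exp (c * x ^ n)) := by fun_prop
  have key : ∀ h p : ℝ, 0 < h → 0 ≤ p →
      Real.log (1 + h * p) ≤ Real.log (1 + t) + e * Real.exp (c * h ^ n) + p := by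
    intro h p hh0 hp
    -- Since `1 + h * p ≤ (1 + h) * (1 + p)`, gain and power separate.
    have h1 : Real.log (1 + h * p) ≤ Real.log (1 + h) + p := by
      have : Real.log (1 + h * p) ≤ Real.log ((1 + h) * (1 + p)) :=
        Real.log_le_log (by positivity) (by nlinarith)
      rw [Real.log_mul (by positivity) (by positivity)] at this
      linarith [Real.log_le_sub_one_of_pos (by positivity : 0 < 1 + p)]
    have h2 : Real.log (1 + h) ≤ Real.log (1 + t) + e * Real.exp (c * h ^ n) := by
      rcases le_total h t with hle | hle
      · have := Real.log_le_log (by positivity : 0 < 1 + h) (by linarith : 1 + h ≤ 1 + t)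
        have : 0 ≤ e * Real.exp (c * h ^ n) := by positivity
        linarith
      · have h3 := Real.log_le_sub_one_of_pos (by positivity : 0 < 1 + h)
        have h4 := le_rpow_mul_exp_rpow hn hc2 hh0.le
        have h5 : t ^ n ≤ h ^ n := Real.rpow_le_rpow ht hle hn.le
        have h6 : d * Real.exp (c / 2 * h ^ n) ≤ e * Real.exp (c * h ^ n) := by
          rw [he, mul_assoc, ← Real.exp_add]
          gcongr
          nlinarith
        have h7 : 0 ≤ Real.log (1 + t) := Real.log_nonneg (by linarith)
        linarith
    linarith
  calc ∫⁻ x in A, ENNReal.ofReal (π.rate x) ∂(μh.prod μg)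
      ≤ ∫⁻ x in A, (ENNReal.ofReal (Real.log (1 + t))
          + ENNReal.ofReal e * ENNReal.ofReal (Real.exp (c * x.1 ^ n))
          + ENNReal.ofReal (π.power x)) ∂(μh.prod μg) := by
        refine lintegral_mono_ae ?_
        filter_upwards [hpos] with x hx
        rw [← ENNReal.ofReal_mul he0, ← ENNReal.ofReal_add (Real.log_nonneg (by linarith))
          (by positivity), ← ENNReal.ofReal_add (by
            have := Real.log_nonneg (by linarith : 1 ≤ 1 + t); positivity) (π.power_nonneg x)]
        exact ENNReal.ofReal_le_ofReal (key x.1 (π.power x) hx (π.power_nonneg x))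
    _ = ENNReal.ofReal (Real.log (1 + t)) * (μh.prod μg) A
          + ENNReal.ofReal e
            * ∫⁻ x in A, ENNReal.ofReal (Real.exp (c * x.1 ^ n)) ∂(μh.prod μg)
          + ∫⁻ x in A, ENNReal.ofReal (π.power x) ∂(μh.prod μg) := by
        rw [lintegral_add_right _ π.measurable_power.ennreal_ofReal,
          lintegral_add_left measurable_const, setLIntegral_const,
          lintegral_const_mul _ (by fun_prop)]
    _ ≤ _ := by
        gcongr
        rw [mul_right_comm, ENNReal.ofReal_mul he0]
        gcongr
        calc _ ≤ ∫⁻ x, ENNReal.ofReal (Real.exp (c * x.1 ^ n)) ∂(μh.prod μg) :=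
              setLIntegral_le_lintegral _ _
          _ = ∫⁻ y, ENNReal.ofReal (Real.exp (c * y ^ n)) ∂μh :=
              measurePreserving_fst.lintegral_comp hm
          _ ≤ _ := hmom

/-- Serving the strongest users with constant power is feasible, and bounds the optimal mean
rate below. -/
theorem IsClassC.exists_le_meanRate {μh μg : Measure ℝ} [IsProbabilityMeasure μh]
    [IsProbabilityMeasure μg] {nh ng : ℝ} (hh : IsClassC (cdf μh) nh)
    (hg : IsClassC (cdf μg) ng) {Pave Qave : ℝ} (hP : 0 < Pave) (hQ : 0 < Qave) :
    ∃ p B : ℝ, 0 < p ∧ 0 < B ∧ ∀ᶠ N : ℕ in atTop, ∀ π : Policy,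
      π.IsOptimal (μh.prod μg) Pave Qave N (1 / (N : ℝ)) →
      ENNReal.ofReal (Real.log (1 + p * (Real.log N / B) ^ (1 / nh)) * (1 / N))
        ≤ π.meanRate (μh.prod μg) := by
  obtain ⟨_, B, _, hB, htail⟩ := hh.tail_bounds
  have hn := hh.exponent_pos
  obtain ⟨c, K, hc, hK, hmom⟩ := hg.exists_exp_moment
  obtain ⟨m, hm0, hm⟩ : ∃ m : ℝ, 0 < m ∧
      ∫⁻ y, ENNReal.ofReal y ∂μg ≤ ENNReal.ofReal m := by
    set d : ℝ := (c * ng) ^ (-(1 / ng)) with hd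
    have hd0 : 0 < d := Real.rpow_pos_of_pos (mul_pos hc hg.exponent_pos) _
    -- The `+ 1` makes `m` positive, as `Qave / m` requires.
    refine ⟨d * K + 1, by positivity, ?_⟩
    calc ∫⁻ y, ENNReal.ofReal y ∂μg
        ≤ ∫⁻ y, ENNReal.ofReal d * ENNReal.ofReal (Real.exp (c * y ^ ng)) ∂μg := by
          refine lintegral_mono_ae ?_
          filter_upwards [hg.ae_pos] with y hy
          rw [← ENNReal.ofReal_mul hd0.le]
          exact ENNReal.ofReal_le_ofReal (le_rpow_mul_exp_rpow hg.exponent_pos hc hy.le)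
      _ = ENNReal.ofReal d * ∫⁻ y, ENNReal.ofReal (Real.exp (c * y ^ ng)) ∂μg :=
          lintegral_const_mul _ (by fun_prop)
      _ ≤ ENNReal.ofReal d * ENNReal.ofReal K := by gcongr
      _ ≤ _ := by
          rw [← ENNReal.ofReal_mul hd0.le]
          exact ENNReal.ofReal_le_ofReal (by linarith)
  -- Scheduling by `h` alone leaves `g` unbiased, so the interference is at most `p * m / N`.
  set p : ℝ := min Pave (Qave / m) with hp
  have hp0 : 0 < p := lt_min hP (by positivity)
  have hpm : p * m ≤ Qave := (le_div_iff₀ hm0).1 (min_le_right _ _)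
  refine ⟨p, B, hp0, hB, ?_⟩
  have hs : Tendsto (fun N : ℕ => (Real.log N / B) ^ (1 / nh)) atTop atTop :=
    (tendsto_rpow_atTop (by positivity : 0 < 1 / nh)).comp
      ((Real.tendsto_log_atTop.comp tendsto_natCast_atTop_atTop).atTop_div_const hB)
  filter_upwards [hs.eventually htail, eventually_ge_atTop 2] with N hN hN2 π hπ
  have hN0 : (0 : ℝ) < N := by exact_mod_cast (by omega : 0 < N)
  have hlogN : 0 ≤ Real.log N := Real.log_natCast_nonneg N
  set s : ℝ := (Real.log N / B) ^ (1 / nh) with hsdef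
  have hs0 : 0 ≤ s := Real.rpow_nonneg (by positivity) _
  have hsn : s ^ nh = Real.log N / B := by
    rw [hsdef, ← Real.rpow_mul (by positivity), one_div_mul_cancel hn.ne', Real.rpow_one]
  have hFs : cdf μh s ≤ 1 - 1 / N := by
    have h1 := hN.1
    rw [hsn, show -B * (Real.log N / B) = -Real.log N by field_simp, Real.exp_neg,
      Real.exp_log hN0, ← one_div] at h1
    linarith
  -- The scheduling constraint is an equality, so the threshold is raised from `s` until the tail is
  -- exactly `1 / N`.
  obtain ⟨t, hst, ht⟩ : ∃ t, s ≤ t ∧ cdf μh t = 1 - 1 / N := by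
    have h1 : (1 : ℝ) - 1 / N < 1 := by
      have : 0 < 1 / (N : ℝ) := by positivity
      linarith
    obtain ⟨u, hu, hsu⟩ := (((tendsto_cdf_atTop μh).eventually_const_lt h1).and
      (eventually_ge_atTop s)).exists
    obtain ⟨t, ht, hte⟩ := intermediate_value_Icc hsu hh.continuous.continuousOn ⟨hFs, hu.le⟩
    exact ⟨t, ht.1, hte⟩
  have hS : MeasurableSet (Set.Ioi t ×ˢ (Set.univ : Set ℝ)) :=
    measurableSet_Ioi.prod MeasurableSet.univ
  let σ : Policy :=
    { power := fun _ => p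
      sched := Set.Ioi t ×ˢ Set.univ
      measurable_power := measurable_const
      power_nonneg := fun _ => hp0.le
      measurableSet_sched := hS }
  have hprob : (μh.prod μg) σ.sched = ENNReal.ofReal (1 / N) := by
    simp only [σ]
    rw [Measure.prod_prod, measure_univ, mul_one, measure_Ioi_eq_one_sub_cdf, ht, sub_sub_cancel]
  have hfeas : σ.Feasible (μh.prod μg) Pave Qave N (1 / N) := by
    refine ⟨?_, ?_, hprob⟩
    · change ∫⁻ _ in σ.sched, ENNReal.ofReal p ∂(μh.prod μg) ≤ _
      rw [setLIntegral_const, hprob, ← ENNReal.ofReal_mul hp0.le, mul_one_div]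
      exact ENNReal.ofReal_le_ofReal (by gcongr; exact min_le_left _ _)
    · change ∫⁻ x in Set.Ioi t ×ˢ Set.univ, ENNReal.ofReal (x.2 * p) ∂(μh.prod μg) ≤ _
      calc ∫⁻ x in Set.Ioi t ×ˢ Set.univ, ENNReal.ofReal (x.2 * p) ∂(μh.prod μg)
          = ENNReal.ofReal (1 / N) * ∫⁻ y, ENNReal.ofReal (y * p) ∂μg := by
            rw [← Measure.prod_restrict, Measure.restrict_univ,
              lintegral_prod _ (by fun_prop)]
            simp only [lintegral_const, Measure.restrict_apply_univ]
            rw [measure_Ioi_eq_one_sub_cdf, ht, sub_sub_cancel, mul_comm]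
        _ = ENNReal.ofReal (1 / N) * (ENNReal.ofReal p * ∫⁻ y, ENNReal.ofReal y ∂μg) := by
            rw [← lintegral_const_mul _ ENNReal.measurable_ofReal]
            congr 1
            refine lintegral_congr fun y => ?_
            rw [mul_comm, ENNReal.ofReal_mul hp0.le]
        _ ≤ ENNReal.ofReal (1 / N) * (ENNReal.ofReal p * ENNReal.ofReal m) := by gcongr
        _ ≤ _ := by
            rw [← ENNReal.ofReal_mul hp0.le, ← ENNReal.ofReal_mul (by positivity),
              one_div_mul_eq_div]
            exact ENNReal.ofReal_le_ofReal (by gcongr)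
  refine le_trans ?_ (hπ.2 σ hfeas)
  have hlog : 0 ≤ Real.log (1 + p * s) := Real.log_nonneg (by nlinarith)
  rw [ENNReal.ofReal_mul hlog, ← hprob, ← setLIntegral_const]
  refine setLIntegral_mono' hS fun x hx => ?_
  refine ENNReal.ofReal_le_ofReal (Real.log_le_log (by positivity) ?_)
  change 1 + p * s ≤ 1 + x.1 * p
  have hx1 : t < x.1 := hx.1
  nlinarith

/-! ### Asymptotics -/

/-- The `N`-th power tends to `exp (-1)`, and dividing by its base, which tends to `1`, lowers the
exponent. -/
theorem tendsto_one_sub_pow_pred {ν : ℕ → ℝ}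
    (h : Tendsto (fun N : ℕ => (N : ℝ) * ν N) atTop (𝓝 1)) :
    Tendsto (fun N : ℕ => (1 - ν N) ^ (N - 1)) atTop (𝓝 (Real.exp 1)⁻¹) := by
  have hν : Tendsto ν atTop (𝓝 0) := by
    refine (h.div_atTop tendsto_natCast_atTop_atTop).congr' ?_
    filter_upwards [eventually_ne_atTop 0] with N hN
    field_simp
  have h1 : Tendsto (fun N : ℕ => (1 + -ν N) ^ N) atTop (𝓝 (Real.exp (-1))) :=
    Real.tendsto_one_add_pow_exp_of_tendsto (by simpa using h.neg)
  have h2 : Tendsto (fun N : ℕ => 1 + -ν N) atTop (𝓝 1) := by simpa using hν.neg.const_add 1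
  have h3 := h1.div h2 one_ne_zero
  rw [div_one, Real.exp_neg] at h3
  refine h3.congr' ?_
  filter_upwards [h2.eventually_ne one_ne_zero, eventually_ge_atTop 1] with N hN hN1
  obtain ⟨k, rfl⟩ := Nat.exists_eq_add_of_le' hN1
  rw [Pi.div_apply, Nat.add_sub_cancel, pow_succ, mul_div_cancel_right₀ _ hN, sub_eq_add_neg]

/-- Asymptotics of the optimal mean rate, and of the probability that an optimal policy
transmits with positive power. -/
theorem IsClassC.tendsto_meanRate {μh μg : Measure ℝ} [IsProbabilityMeasure μh]
    [IsProbabilityMeasure μg] {nh ng : ℝ} (hh : IsClassC (cdf μh) nh)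
    (hg : IsClassC (cdf μg) ng) {Pave Qave : ℝ} (hP : 0 < Pave) (hQ : 0 < Qave)
    {π : ℕ → Policy}
    (hπ : ∀ N : ℕ, 2 ≤ N → (π N).IsOptimal (μh.prod μg) Pave Qave N (1 / (N : ℝ))) :
    (∀ᶠ N : ℕ in atTop, (π N).meanRate (μh.prod μg) ≠ ⊤) ∧
    Tendsto (fun N : ℕ => N * ((π N).meanRate (μh.prod μg)).toReal / Real.log (Real.log N))
      atTop (𝓝 (1 / nh)) ∧
    Tendsto (fun N : ℕ => N * (μh.prod μg).real (π N).active) atTop (𝓝 1) := by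
  obtain ⟨c, D, hc, hD, hup⟩ := hh.exists_setLIntegral_rate_le (μg := μg)
  obtain ⟨p, B, hp, hB, hlow⟩ := hh.exists_le_meanRate hg hP hQ
  have hn := hh.exponent_pos
  set ν := μh.prod μg with hν
  have hlogN : Tendsto (fun N : ℕ => Real.log N) atTop atTop :=
    Real.tendsto_log_atTop.comp tendsto_natCast_atTop_atTop
  have hL : Tendsto (fun N : ℕ => Real.log (Real.log N)) atTop atTop :=
    Real.tendsto_log_atTop.comp hlogN
  have hU := (tendsto_log_rpow_div_log hn one_pos hc).comp hlogN
  have hV := (tendsto_log_rpow_div_log hn hp hB).comp hlogN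
  have hC : Tendsto (fun N : ℕ => (D + Pave) / Real.log (Real.log N)) atTop (𝓝 0) :=
    hL.const_div_atTop _
  have hupper : ∀ N : ℕ, 2 ≤ N → (π N).meanRate ν ≤ ENNReal.ofReal
      (Real.log (1 + 1 * (Real.log N / c) ^ (1 / nh)) * ν.real (π N).active
        + D / N + Pave / N) := by
    intro N hN
    have hN0 : (0 : ℝ) < N := by exact_mod_cast (by omega : 0 < N)
    have hlog0 : 0 ≤ Real.log N := Real.log_natCast_nonneg N
    have ht : 0 ≤ (Real.log N / c) ^ (1 / nh) := Real.rpow_nonneg (by positivity) _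
    have hl : 0 ≤ Real.log (1 + (Real.log N / c) ^ (1 / nh)) := Real.log_nonneg (by linarith)
    -- The level is chosen so that the exponential remainder is exactly `1 / N`.
    have hexp : D * Real.exp (-(c * ((Real.log N / c) ^ (1 / nh)) ^ nh)) = D / N := by
      rw [← Real.rpow_mul (by positivity), one_div_mul_cancel hn.ne', Real.rpow_one,
        mul_div_cancel₀ _ hc.ne', Real.exp_neg, Real.exp_log hN0, div_eq_mul_inv]
    have h := hup (π N) (π N).active _ ht
    rw [hexp, (π N).setLIntegral_rate_of_active_subset ν (π N).measurableSet_active subset_rfl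
      (π N).active_subset_sched] at h
    have hpow : ∫⁻ x in (π N).active, ENNReal.ofReal ((π N).power x) ∂ν
        ≤ ENNReal.ofReal (Pave / N) :=
      (lintegral_mono_set (π N).active_subset_sched).trans (hπ N hN).1.power_le
    rw [one_mul, ENNReal.ofReal_add (by positivity) (by positivity),
      ENNReal.ofReal_add (by positivity) (by positivity), ENNReal.ofReal_mul hl,
      ofReal_measureReal]
    exact h.trans (by gcongr)
  have hfin : ∀ N : ℕ, 2 ≤ N → (π N).meanRate ν ≠ ⊤ := fun N hN =>
    ne_top_of_le_ne_top ENNReal.ofReal_ne_top (hupper N hN)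
  have hbounds : ∀ᶠ N : ℕ in atTop,
      Real.log (1 + p * (Real.log N / B) ^ (1 / nh)) ≤ N * ((π N).meanRate ν).toReal ∧
      N * ((π N).meanRate ν).toReal ≤ Real.log (1 + 1 * (Real.log N / c) ^ (1 / nh))
        * (N * ν.real (π N).active) + (D + Pave) := by
    filter_upwards [hlow, eventually_ge_atTop 2] with N hlowN hN
    have hN0 : (0 : ℝ) < N := by exact_mod_cast (by omega : 0 < N)
    have hlog0 : 0 ≤ Real.log N := Real.log_natCast_nonneg N
    constructor
    · have h := (ENNReal.ofReal_le_iff_le_toReal (hfin N hN)).1 (hlowN (π N) (hπ N hN))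
      rw [mul_one_div, div_le_iff₀ hN0] at h
      linarith
    · have ht : 0 ≤ 1 * (Real.log N / c) ^ (1 / nh) := by positivity
      have hl : 0 ≤ Real.log (1 + 1 * (Real.log N / c) ^ (1 / nh)) :=
        Real.log_nonneg (by linarith)
      have h := ENNReal.toReal_le_of_le_ofReal (by positivity) (hupper N hN)
      refine (mul_le_mul_of_nonneg_left h hN0.le).trans (le_of_eq ?_)
      field_simp
      ring
  have hq1 : ∀ᶠ N : ℕ in atTop, N * ν.real (π N).active ≤ 1 := by
    filter_upwards [eventually_ge_atTop 2] with N hN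
    have hN0 : (0 : ℝ) < N := by exact_mod_cast (by omega : 0 < N)
    have h1 : ν.real (π N).active ≤ 1 / N := by
      refine (measureReal_mono (π N).active_subset_sched).trans (le_of_eq ?_)
      rw [Measure.real, (hπ N hN).1.sched_prob, ENNReal.toReal_ofReal (by positivity)]
    rwa [le_div_iff₀ hN0, mul_comm] at h1
  refine ⟨(eventually_ge_atTop 2).mono hfin, ?_, ?_⟩
  · have hUC := hU.add hC
    rw [add_zero] at hUC
    refine tendsto_of_tendsto_of_tendsto_of_le_of_le' hV hUC ?_ ?_
    · filter_upwards [hbounds, hL.eventually_gt_atTop 0] with N hb hL0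
      exact div_le_div_of_nonneg_right hb.1 hL0.le
    · filter_upwards [hbounds, hL.eventually_gt_atTop 0, hq1] with N hb hL0 hq
      have hlog0 : 0 ≤ Real.log N := Real.log_natCast_nonneg N
      have ht : 0 ≤ 1 * (Real.log N / c) ^ (1 / nh) := by positivity
      have hl : 0 ≤ Real.log (1 + 1 * (Real.log N / c) ^ (1 / nh)) :=
        Real.log_nonneg (by linarith)
      rw [Function.comp_apply, ← add_div]
      refine div_le_div_of_nonneg_right ?_ hL0.le
      linarith [hb.2, mul_le_of_le_one_right hl hq]
  -- Solving the two inequalities of `hbounds` for `N * ν.real (π N).active` gives this lower bound.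
  · have hlim : Tendsto (fun N : ℕ =>
        (Real.log (1 + p * (Real.log N / B) ^ (1 / nh)) / Real.log (Real.log N)
          - (D + Pave) / Real.log (Real.log N))
        / (Real.log (1 + 1 * (Real.log N / c) ^ (1 / nh)) / Real.log (Real.log N)))
        atTop (𝓝 1) := by
      have hne : 1 / nh ≠ 0 := by positivity
      have := (hV.sub hC).div hU hne
      rwa [sub_zero, div_self hne] at this
    refine tendsto_of_tendsto_of_tendsto_of_le_of_le' hlim tendsto_const_nhds ?_ hq1
    filter_upwards [hbounds, hL.eventually_gt_atTop 0,
      hU.eventually_const_lt (by positivity : 0 < 1 / nh)] with N hb hL0 hU0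
    simp only [Function.comp_apply] at hU0
    rw [div_le_iff₀ hU0, ← sub_div, ← mul_div_assoc]
    refine div_le_div_of_nonneg_right ?_ hL0.le
    linarith [hb.1, hb.2]

/-- The sum-rate of optimal policies, for any set of transmitting states between the active and
the scheduled ones. -/
theorem IsClassC.tendsto_sumRate {μh μg : Measure ℝ} [IsProbabilityMeasure μh]
    [IsProbabilityMeasure μg] {nh ng : ℝ} (hh : IsClassC (cdf μh) nh)
    (hg : IsClassC (cdf μg) ng) {Pave Qave : ℝ} (hP : 0 < Pave) (hQ : 0 < Qave)
    {π : ℕ → Policy}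
    (hπ : ∀ N : ℕ, 2 ≤ N → (π N).IsOptimal (μh.prod μg) Pave Qave N (1 / (N : ℝ)))
    {T : ℕ → Set (ℝ × ℝ)} (hT : ∀ N, MeasurableSet (T N)) (h₁ : ∀ N, (π N).active ⊆ T N)
    (h₂ : ∀ N, T N ⊆ (π N).sched) :
    Tendsto (fun N : ℕ => (π N).sumRate (μh.prod μg) N (T N) / Real.log (Real.log (N : ℝ)))
      atTop (𝓝 (1 / (Real.exp 1 * nh))) := by
  obtain ⟨hfin, hrate, hact⟩ := hh.tendsto_meanRate hg hP hQ hπ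
  set ν := μh.prod μg with hν
  have hTprob : Tendsto (fun N : ℕ => N * ν.real (T N)) atTop (𝓝 1) := by
    refine tendsto_of_tendsto_of_tendsto_of_le_of_le' hact tendsto_const_nhds
      (.of_forall fun N => ?_) ?_
    · exact mul_le_mul_of_nonneg_left (measureReal_mono (h₁ N)) N.cast_nonneg
    · filter_upwards [eventually_ge_atTop 2] with N hN
      have hN0 : (0 : ℝ) < N := by exact_mod_cast (by omega : 0 < N)
      have h1 : ν.real (T N) ≤ 1 / N := by
        refine (measureReal_mono (h₂ N)).trans (le_of_eq ?_)
        rw [Measure.real, (hπ N hN).1.sched_prob, ENNReal.toReal_ofReal (by positivity)]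
      rwa [le_div_iff₀ hN0, mul_comm] at h1
  have hlim := hrate.mul (tendsto_one_sub_pow_pred hTprob)
  rw [show 1 / nh * (Real.exp 1)⁻¹ = 1 / (Real.exp 1 * nh) by
    rw [one_div, ← mul_inv, one_div, mul_comm]] at hlim
  refine hlim.congr' ?_
  filter_upwards [hfin] with N hN
  have hset := (π N).setLIntegral_rate_of_active_subset ν (hT N) (h₁ N) (h₂ N)
  have hnonneg : 0 ≤ᵐ[ν.restrict (T N)] (π N).rate := by
    refine ae_restrict_of_ae ?_
    filter_upwards [(measurePreserving_fst (μ := μh) (ν := μg)).quasiMeasurePreserving.ae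
      hh.ae_pos] with x hx
    exact Real.log_nonneg (by have := mul_nonneg hx.le ((π N).power_nonneg x); linarith)
  have hmeas : AEStronglyMeasurable (π N).rate (ν.restrict (T N)) :=
    (π N).measurable_rate.aestronglyMeasurable
  have hint : IntegrableOn (π N).rate (T N) ν :=
    (lintegral_ofReal_ne_top_iff_integrable hmeas hnonneg).1 (by rwa [hset])
  rw [(π N).sumRate_eq ν N (hT N) hint, integral_eq_lintegral_of_nonneg_ae hnonneg hmeas, hset]
  ring

theorem theorem2
    -- laws of the gains to the secondary and to the primary base station
    (μh μg : Measure ℝ) [IsProbabilityMeasure μh] [IsProbabilityMeasure μg]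
    (nh ng : ℝ) (hh : IsClassC (cdf μh) nh) (hg : IsClassC (cdf μg) ng)
    (Pave Qave : ℝ) (hP : 0 < Pave) (hQ : 0 < Qave)
    -- for each number of users, any optimal policy with scheduling probability `1 / N`
    (π : ℕ → Policy)
    (hπ : ∀ N : ℕ, 2 ≤ N → (π N).IsOptimal (μh.prod μg) Pave Qave N (1 / (N : ℝ))) :
    -- every scheduled user counts as transmitting
    Tendsto (fun N : ℕ => (π N).sumRate (μh.prod μg) N (π N).sched /
      Real.log (Real.log (N : ℝ))) atTop (𝓝 (1 / (Real.exp 1 * nh))) ∧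
    -- a scheduled user with zero power counts as silent
    Tendsto (fun N : ℕ => (π N).sumRate (μh.prod μg) N (π N).active /
      Real.log (Real.log (N : ℝ))) atTop (𝓝 (1 / (Real.exp 1 * nh))) := by
  exact ⟨hh.tendsto_sumRate hg hP hQ hπ (fun N => (π N).measurableSet_sched)
      (fun N => (π N).active_subset_sched) (fun _ => subset_rfl),
    hh.tendsto_sumRate hg hP hQ hπ (fun N => (π N).measurableSet_active)
      (fun _ => subset_rfl) (fun N => (π N).active_subset_sched)⟩
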